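/- Let $1\le j\le d$ be integers, let $D\subset\mathbb{R}^d$ be open and convex, and let $X\in C^1(D,\mathbb{R}^j)$ be such that its Jacobian $\nabla X$ is Lipschitz on $D$. Let $D_1\subset D$ be open and bounded, and let $Y:D_1\to\mathbb{R}$ be continuous. Put $$D^r_X:=\{x\in D:\ \operatorname{rank}\nabla X(x)=j\},\qquad D^r_{X|_{D_1}}:=D^r_X\cap D_1,$$ and, for $y\in\mathbb{R}^j$, $$\mathcal{C}^{D^r}_{D_1,X}(y):=\{x\in D_1\cap D^r_X:\ X(x)=y\}.$$ Let $\operatorname{supp}(Y)$ be the closure in $\mathbb{R}^d$ of $\{x\in D_1: Y(x)\neq 0\}$, and assume that $\operatorname{supp}(Y)\subset D^r_{X|_{D_1}}$. Let $\sigma_{d-j}$ denote the $(d-j)$-dimensional surface measure in $\mathbb{R}^d$, i.e. the $(d-j)$-dimensional Euclidean Hausdorff measure, normalized so that it agrees with Lebesgue measure on $\mathbb{R}^{d-j}$ (the counting measure if $d=j$). Then, for every $y\in\mathbb{R}^j$, $Y$ is integrable on $\mathcal{C}^{D^r}_{D_1,X}(y)$ with respect to $\sigma_{d-j}$, and the function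 $$y\longmapsto\int_{\mathcal{C}^{D^r}_{D_1,X}(y)}Y(x)\,\mathrm{d}\sigma_{d-j}(x)$$ is continuous on $\mathbb{R}^j$. -/

import Mathlib

open MeasureTheory

/-- The level set `{x ∈ D : G x = y}` of a map `G` defined on `D ⊆ ℝ^d`. -/
def levelSet {d j : ℕ} (D : Set (EuclideanSpace ℝ (Fin d)))
    (G : EuclideanSpace ℝ (Fin d) → EuclideanSpace ℝ (Fin j)) (y : EuclideanSpace ℝ (Fin j)) :
    Set (EuclideanSpace ℝ (Fin d)) :=
  {x | x ∈ D ∧ G x = y}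

/-- The regular set of `G` on an open set `D`: the points of `D` where the derivative of `G`
has rank `j`. -/
def regularSet {d j : ℕ} (D : Set (EuclideanSpace ℝ (Fin d)))
    (G : EuclideanSpace ℝ (Fin d) → EuclideanSpace ℝ (Fin j)) :
    Set (EuclideanSpace ℝ (Fin d)) :=
  {x | x ∈ D ∧ Module.finrank ℝ (LinearMap.range (fderiv ℝ G x).toLinearMap) = j}

/-- The regular part, inside `Q`, of the level set at `y` of `G` (defined on `D`). -/
def regularLevelSet {d j : ℕ} (D Q : Set (EuclideanSpace ℝ (Fin d)))
    (G : EuclideanSpace ℝ (Fin d) → EuclideanSpace ℝ (Fin j)) (y : EuclideanSpace ℝ (Fin j)) :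
    Set (EuclideanSpace ℝ (Fin d)) :=
  levelSet D G y ∩ Q ∩ regularSet D G

/-- The support of a function `Y` defined on `Q ⊆ ℝ^d`: the closure in `ℝ^d` of the set of points
of `Q` where `Y` does not vanish (values of `Y` outside `Q` are ignored). -/
def supportOn {d : ℕ} (Q : Set (EuclideanSpace ℝ (Fin d))) (Y : EuclideanSpace ℝ (Fin d) → ℝ) :
    Set (EuclideanSpace ℝ (Fin d)) :=
  closure {x | x ∈ Q ∧ Y x ≠ 0}

open scoped NNReal ENNReal Topology
open Set Module

/-! Neither an area formula nor a parametrization of the fibers is needed. At a regular point `p`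
let `A` be the derivative of `X` and `P` the orthogonal projection onto `ker A`. Then `(X, P)` is a
local homeomorphism `Φ`. On each fiber near `p`, `P` is 1-Lipschitz with a `K`-Lipschitz inverse,
where `K > 1` is as close to 1 as desired. So for `φ ≥ 0` supported near `p`, the fiber integral
lies between `J y = ∫ φ (Φ.symm (y, v)) dv` and `K ^ m * J y`, and `J` is continuous
(`HasStrictFDerivAt.exists_continuous_le_lintegral_fiber_le`).

A partition of unity globalizes this bound, and a function squeezed in this way for every factor `c
> 1` is continuous (`continuous_of_forall_exists_le_mul`). Splitting into positive and negative
parts removes the sign condition. The theorem follows for `Y` extended by zero. -/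

/-! ### Hausdorff measure under Lipschitz maps -/

theorem LipschitzOnWith.euclideanHausdorffMeasure_image_le {A B : Type*}
    [EMetricSpace A] [MeasurableSpace A] [BorelSpace A]
    [EMetricSpace B] [MeasurableSpace B] [BorelSpace B] {K : ℝ≥0} {f : A → B} {s : Set A}
    (h : LipschitzOnWith K f s) (m : ℕ) :
    μHE[m] (f '' s) ≤ (K : ℝ≥0∞) ^ m * μHE[m] s := by
  simp only [Measure.euclideanHausdorffMeasure_def, Measure.smul_apply, ENNReal.smul_def,
    smul_eq_mul]
  rw [mul_left_comm]
  gcongr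
  simpa using h.hausdorffMeasure_image_le (d := m) (by positivity)

section Projection

variable {A B : Type*} [EMetricSpace A] [MeasurableSpace A] [BorelSpace A]
  [EMetricSpace B] [MeasurableSpace B] [BorelSpace B] {P : A → B} {s : Set A}

/-- Source of the lower bound on fiber integrals: a 1-Lipschitz map does not increase Hausdorff
measure. -/
theorem LipschitzOnWith.euclideanHausdorffMeasure_restrict_image_le_map
    (h : LipschitzOnWith 1 P s) (hP : Measurable P) (m : ℕ) :
    (μHE[m] : Measure B).restrict (P '' s) ≤ ((μHE[m] : Measure A).restrict s).map P := by
  refine Measure.le_iff.2 fun T hT => ?_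
  rw [Measure.map_apply hP hT, Measure.restrict_apply hT, Measure.restrict_apply (hP hT)]
  have := (h.mono (inter_subset_right (s := P ⁻¹' T))).euclideanHausdorffMeasure_image_le m
  rwa [image_preimage_inter, ENNReal.coe_one, one_pow, one_mul] at this

/-- Source of the upper bound: `P` is injective on `s` with a `K`-Lipschitz inverse, which scales
`m`-dimensional measure by at most `K ^ m`. -/
theorem map_euclideanHausdorffMeasure_restrict_le {K : ℝ≥0}
    (h : ∀ a ∈ s, ∀ b ∈ s, edist a b ≤ K * edist (P a) (P b)) (hP : Measurable P) (m : ℕ) :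
    ((μHE[m] : Measure A).restrict s).map P ≤ ((K : ℝ≥0∞) ^ m) • (μHE[m] : Measure B) := by
  refine Measure.le_iff.2 fun T hT => ?_
  rw [Measure.map_apply hP hT, Measure.restrict_apply (hP hT), Measure.smul_apply, smul_eq_mul]
  rcases isEmpty_or_nonempty A with hA | hA
  · simp [eq_empty_of_isEmpty]
  have hinj : InjOn P s := fun a ha b hb hab => by
    have := h a ha b hb
    rw [hab, edist_self, mul_zero] at this
    exact edist_le_zero.1 this
  set G := Function.invFunOn P s with hG
  have hinv : ∀ a ∈ s, G (P a) = a := fun a ha => hinj.leftInvOn_invFunOn ha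
  have hL : LipschitzOnWith K G (P '' s) := by
    rintro _ ⟨a, ha, rfl⟩ _ ⟨b, hb, rfl⟩
    rw [hinv a ha, hinv b hb]
    exact h a ha b hb
  have him : G '' (P '' (P ⁻¹' T ∩ s)) = P ⁻¹' T ∩ s := by
    rw [image_image]
    exact (image_congr fun a ha => hinv a ha.2).trans (image_id' _)
  calc μHE[m] (P ⁻¹' T ∩ s) = μHE[m] (G '' (P '' (P ⁻¹' T ∩ s))) := by rw [him]
    _ ≤ (K : ℝ≥0∞) ^ m * μHE[m] (P '' (P ⁻¹' T ∩ s)) :=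
      (hL.mono (image_mono inter_subset_right)).euclideanHausdorffMeasure_image_le m
    _ ≤ (K : ℝ≥0∞) ^ m * μHE[m] T := by
      gcongr
      rw [image_preimage_inter]
      exact inter_subset_left

end Projection

/-! ### Topological and linear preliminaries -/

theorem ContinuousOn.measurableSet_inter_fiber {A B : Type*} [TopologicalSpace A]
    [MeasurableSpace A] [BorelSpace A] [TopologicalSpace B] [T1Space B] {f : A → B} {s : Set A}
    (hf : ContinuousOn f s) (hs : IsOpen s) (y : B) : MeasurableSet {x | x ∈ s ∧ f x = y} := by
  have h := hf.isOpen_inter_preimage hs (isOpen_compl_singleton (x := y))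
  convert hs.measurableSet.diff h.measurableSet using 1
  ext x
  simp +contextual

/-- A function squeezed, up to factors arbitrarily close to one, by continuous functions is
continuous. -/
theorem continuous_of_forall_exists_le_mul {F : Type*} [TopologicalSpace F] {g : F → ℝ}
    (h : ∀ c : ℝ, 1 < c → ∃ J : F → ℝ, Continuous J ∧ ∀ y, J y ≤ g y ∧ g y ≤ c * J y) :
    Continuous g := by
  rw [continuous_iff_continuousAt]
  intro y₀
  have hg : 0 ≤ g y₀ := by
    obtain ⟨J, -, hJ⟩ := h 2 one_lt_two
    linarith [hJ y₀]
  rw [ContinuousAt, Metric.tendsto_nhds]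
  intro ε hε
  -- Near `y₀`, `J y ≤ g y₀ + 1`, so the factor `1 + δ` costs at most `ε / 4`; the variation of `J`
  -- costs another `ε / 4`.
  set δ := ε / (4 * (g y₀ + 1)) with hδ
  have hδ0 : 0 < δ := by positivity
  have hδε : δ * (g y₀ + 1) = ε / 4 := by rw [hδ]; field_simp
  obtain ⟨J, hJc, hJ⟩ := h (1 + δ) (by linarith)
  have hη : 0 < min (ε / 4) 1 := by positivity
  filter_upwards [Metric.tendsto_nhds.1 hJc.continuousAt _ hη] with y hy
  rw [Real.dist_eq, lt_min_iff] at hy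
  rw [Real.dist_eq]
  obtain ⟨h1, h2⟩ := hJ y
  obtain ⟨h3, h4⟩ := hJ y₀
  have h5 := abs_lt.1 hy.1
  have h6 := abs_lt.1 hy.2
  have h7 : δ * J y ≤ δ * (g y₀ + 1) := by gcongr; linarith
  have h8 : δ * J y₀ ≤ δ * (g y₀ + 1) := by gcongr; linarith
  rw [abs_lt]
  constructor <;> linarith

/-- A surjective `A` and the orthogonal projection onto its kernel are together an isomorphism. -/
theorem ContinuousLinearMap.exists_prod_orthogonalProjectionOnto_ker_equiv {E F : Type*}
    [NormedAddCommGroup E] [InnerProductSpace ℝ E] [FiniteDimensional ℝ E]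
    [NormedAddCommGroup F] [NormedSpace ℝ F] [FiniteDimensional ℝ F]
    (A : E →L[ℝ] F) (hA : Function.Surjective A) :
    ∃ e : E ≃L[ℝ] F × A.ker, (e : E →L[ℝ] F × A.ker) = A.prod (A.ker.orthogonalProjectionOnto) := by
  have : CompleteSpace F := FiniteDimensional.complete ℝ F
  have : CompleteSpace E := FiniteDimensional.complete ℝ E
  refine ⟨ContinuousLinearMap.equivProdOfSurjectiveOfIsCompl A A.ker.orthogonalProjectionOnto
    (LinearMap.range_eq_top.2 hA) ?_ ?_, ?_⟩
  · exact LinearMap.range_eq_top.2 fun v => ⟨v, by simp⟩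
  · rw [Submodule.ker_orthogonalProjectionOnto]
    exact Submodule.isCompl_orthogonal A.ker
  · ext x <;> simp

/-! ### Fibers near a regular point -/

section Local

variable {E F : Type*} [NormedAddCommGroup E] [InnerProductSpace ℝ E] [FiniteDimensional ℝ E]
    [NormedAddCommGroup F] [NormedSpace ℝ F] [FiniteDimensional ℝ F]

/-- Near a regular point of `X`, the map `X` together with the orthogonal projection onto the
kernel of the derivative is a local homeomorphism, and on the fibers of `X` the projection has a
Lipschitz inverse with constant close to one. -/
theorem HasStrictFDerivAt.exists_openPartialHomeomorph_prod_ker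
    {X : E → F} {A : E →L[ℝ] F} {p : E} (hX : HasStrictFDerivAt X A p)
    (hA : Function.Surjective A) {U : Set E} (hU : U ∈ 𝓝 p) {K : ℝ≥0} (hK : 1 < K) :
    ∃ Φ : OpenPartialHomeomorph E (F × A.ker), p ∈ Φ.source ∧ Φ.source ⊆ U ∧
      (∀ x, Φ x = (X x, A.ker.orthogonalProjectionOnto x)) ∧
      ∀ a ∈ Φ.source, ∀ b ∈ Φ.source, X a = X b →
        edist a b ≤ K * edist (A.ker.orthogonalProjectionOnto a)
          (A.ker.orthogonalProjectionOnto b) := by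
  have : CompleteSpace E := FiniteDimensional.complete ℝ E
  obtain ⟨e, he⟩ := A.exists_prod_orthogonalProjectionOnto_ker_equiv hA
  set P := A.ker.orthogonalProjectionOnto with hP
  have he' : ∀ x, e x = (A x, P x) := fun x => by
    simpa using congrArg (fun f : E →L[ℝ] F × A.ker => f x) he
  have hXP : HasStrictFDerivAt (fun x => (X x, P x)) (e : E →L[ℝ] F × A.ker) p := by
    rw [he]
    exact hX.prodMk P.hasStrictFDerivAt
  set C : ℝ := ‖(e.symm : F × A.ker →L[ℝ] E)‖ with hC
  have hC0 : 0 ≤ C := by positivity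
  have hker : ∀ x : E, ‖x‖ ≤ ‖P x‖ + C * ‖A x‖ := fun x => by
    have h1 : e (x - P x) = (A x, 0) := by
      rw [he']
      ext
      · have : A (P x) = 0 := (P x).2
        simp [this]
      · have : P (P x : E) = P x := Submodule.orthogonalProjectionOnto_mem_subspace_eq_self (P x)
        simp [this]
    have h2 : ‖x - P x‖ ≤ C * ‖A x‖ := by
      have h3 := (e.symm : F × A.ker →L[ℝ] E).le_opNorm (e (x - P x))
      rw [ContinuousLinearEquiv.coe_coe, e.symm_apply_apply, h1] at h3
      simpa [Prod.norm_def] using h3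
    calc ‖x‖ = ‖(P x : E) + (x - P x)‖ := by simp
      _ ≤ ‖(P x : E)‖ + ‖x - P x‖ := norm_add_le _ _
      _ ≤ ‖P x‖ + C * ‖A x‖ := add_le_add le_rfl h2
  have hK' : (1 : ℝ) < K := by exact_mod_cast hK
  -- If `X a = X b`, strict differentiability gives `‖A (a - b)‖ ≤ c * ‖a - b‖`. Since `C * c ≤ 1 -
  -- K⁻¹`, this term of `hker` is absorbed, leaving `K⁻¹ * ‖a - b‖ ≤ ‖P (a - b)‖`.
  set c : ℝ≥0 := (1 - K⁻¹) / (‖(e.symm : F × A.ker →L[ℝ] E)‖₊ + 1) with hc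
  have hKinv : K⁻¹ < 1 := inv_lt_one_of_one_lt₀ hK
  have hc0 : 0 < c := div_pos (tsub_pos_of_lt hKinv) (by positivity)
  have hcr : (c : ℝ) * (C + 1) = 1 - (K : ℝ)⁻¹ := by
    rw [hc, NNReal.coe_div, NNReal.coe_sub hKinv.le]
    push_cast
    rw [← hC]
    field_simp
  obtain ⟨s, hs, hsX⟩ := hX.approximates_deriv_on_nhds (c := c) (Or.inr hc0)
  have hN : interior (U ∩ s) ∈ 𝓝 p := interior_mem_nhds.2 (Filter.inter_mem hU hs)
  set Φ₀ := hXP.toOpenPartialHomeomorph (fun x => (X x, P x)) with hΦ₀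
  have hsrc : (Φ₀.restrOpen _ isOpen_interior : OpenPartialHomeomorph E (F × A.ker)).source
      = Φ₀.source ∩ interior (U ∩ s) := Φ₀.restrOpen_source _ isOpen_interior
  refine ⟨Φ₀.restrOpen (interior (U ∩ s)) isOpen_interior, ?_, ?_, ?_, ?_⟩
  · rw [hsrc]
    exact ⟨hXP.mem_toOpenPartialHomeomorph_source, mem_of_mem_nhds hN⟩
  · rw [hsrc]
    exact fun x hx => (interior_subset hx.2).1
  · intro x
    rfl
  · intro a ha b hb hab
    rw [hsrc] at ha hb
    have h1 := hsX a (interior_subset ha.2).2 b (interior_subset hb.2).2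
    rw [hab, sub_self, zero_sub, norm_neg] at h1
    have h2 := hker (a - b)
    have h3 : ‖a - b‖ ≤ K * ‖P (a - b)‖ := by
      have h4 : C * ‖A (a - b)‖ ≤ C * (c * ‖a - b‖) := by gcongr
      have h5 : C * (c * ‖a - b‖) ≤ (1 - (K : ℝ)⁻¹) * ‖a - b‖ := by
        rw [← hcr]
        nlinarith [mul_nonneg c.coe_nonneg (norm_nonneg (a - b))]
      have h6 : (K : ℝ)⁻¹ * ‖a - b‖ ≤ ‖P (a - b)‖ := by linarith
      rwa [inv_mul_le_iff₀ (by linarith)] at h6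
    rw [edist_nndist, edist_nndist, ← ENNReal.coe_mul, ENNReal.coe_le_coe, ← NNReal.coe_le_coe]
    simpa [dist_eq_norm, ← map_sub] using h3

variable [MeasurableSpace E] [BorelSpace E]

/-- Near a regular point of `X`, the integrals of a nonnegative function over the fibers of `X`
are, up to a factor close to one, continuous. -/
theorem HasStrictFDerivAt.exists_continuous_le_lintegral_fiber_le
    {X : E → F} {A : E →L[ℝ] F} {p : E} (hX : HasStrictFDerivAt X A p)
    (hA : Function.Surjective A) {U : Set E} (hU : IsOpen U) (hpU : p ∈ U)
    (hXU : ContinuousOn X U) {c : ℝ≥0} (hc : 1 < c) :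
    ∃ N : Set E, IsOpen N ∧ p ∈ N ∧ ∀ φ : E → ℝ, Continuous φ → (∀ x, 0 ≤ φ x) →
      HasCompactSupport φ → tsupport φ ⊆ N →
      ∃ J : F → ℝ, Continuous J ∧ (∀ y, 0 ≤ J y) ∧ ∀ y,
        ENNReal.ofReal (J y) ≤
          ∫⁻ x in {x | x ∈ U ∧ X x = y}, ENNReal.ofReal (φ x) ∂μHE[finrank ℝ A.ker] ∧
        ∫⁻ x in {x | x ∈ U ∧ X x = y}, ENNReal.ofReal (φ x) ∂μHE[finrank ℝ A.ker] ≤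
          c * ENNReal.ofReal (J y) := by
  set m := finrank ℝ A.ker with hm
  obtain ⟨K, hK1, hKc⟩ : ∃ K : ℝ≥0, 1 < K ∧ K ^ m ≤ c := by
    have h : Filter.Tendsto (fun K : ℝ≥0 => K ^ m) (𝓝[>] 1) (𝓝 (1 ^ m)) :=
      ((continuous_pow m).tendsto 1).mono_left nhdsWithin_le_nhds
    rw [one_pow] at h
    obtain ⟨K, h1, h2⟩ := ((h.eventually_le_const hc).and self_mem_nhdsWithin).exists
    exact ⟨K, h2, h1⟩
  obtain ⟨Φ, hp, hΦU, hΦ, hbi⟩ :=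
    hX.exists_openPartialHomeomorph_prod_ker hA (hU.mem_nhds hpU) hK1
  set P := A.ker.orthogonalProjectionOnto with hP
  refine ⟨Φ.source, Φ.open_source, hp, fun φ hφc hφ0 hφs hφN => ?_⟩
  -- Extension by zero stays continuous because the support lies in the compact set `Φ '' tsupport
  -- φ` inside the open target.
  set ψ : F × A.ker → ℝ := Φ.target.indicator (fun z => φ (Φ.symm z)) with hψ
  have hsub : Function.support ψ ⊆ Φ '' tsupport φ := fun z hz => by
    have hz' : z ∈ Φ.target := by
      by_contra h
      exact hz (indicator_of_notMem h _)
    refine ⟨Φ.symm z, subset_tsupport _ ?_, Φ.right_inv hz'⟩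
    rw [Function.mem_support, hψ, indicator_of_mem hz'] at hz
    exact hz
  have hcomp : IsCompact (Φ '' tsupport φ) :=
    hφs.image_of_continuousOn (Φ.continuousOn.mono hφN)
  have htsub : tsupport ψ ⊆ Φ '' tsupport φ := closure_minimal hsub hcomp.isClosed
  have hψs : HasCompactSupport ψ := hcomp.of_isClosed_subset isClosed_closure htsub
  have hψc : Continuous ψ := by
    refine continuous_of_tsupport fun z hz => ?_
    obtain ⟨x, hx, rfl⟩ := htsub hz
    have hxt : Φ x ∈ Φ.target := Φ.map_source (hφN hx)
    have h1 : ContinuousAt (fun z => φ (Φ.symm z)) (Φ x) :=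
      hφc.continuousAt.comp (Φ.symm.continuousAt hxt)
    refine h1.congr ?_
    filter_upwards [Φ.open_target.mem_nhds hxt] with w hw
    rw [hψ, indicator_of_mem hw]
  have hψ0 : ∀ z, 0 ≤ ψ z := fun z => indicator_nonneg (fun w _ => hφ0 _) z
  have hψφ : ∀ x ∈ Φ.source, ψ (X x, P x) = φ x := fun x hx => by
    rw [← hΦ, hψ, indicator_of_mem (Φ.map_source hx), Φ.left_inv hx]
  have hcy : ∀ y, Continuous fun v => ψ (y, v) := fun y => by fun_prop
  -- One compact set serves all `y`, as continuity of the parametric integral requires.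
  set k : Set A.ker := Prod.snd '' tsupport ψ with hk
  have hkc : IsCompact k := hψs.image continuous_snd
  have hψk : ∀ y v, v ∉ k → ψ (y, v) = 0 := fun y v hv => by
    by_contra h
    exact hv ⟨(y, v), subset_tsupport _ h, rfl⟩
  have hint : ∀ y, Integrable (fun v => ψ (y, v)) (μHE[m] : Measure A.ker) := fun y =>
    (hcy y).integrable_of_hasCompactSupport (HasCompactSupport.intro hkc (hψk y))
  refine ⟨fun y => ∫ v, ψ (y, v) ∂μHE[m], ?_, fun y => integral_nonneg fun v => hψ0 _,
    fun y => ?_⟩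
  · rw [← continuousOn_univ]
    exact continuousOn_integral_of_compact_support hkc
      (f := fun y v => ψ (y, v)) hψc.continuousOn fun y v _ hv => hψk y v hv
  set S : Set E := {x | x ∈ Φ.source ∧ X x = y} with hS
  have hSm : MeasurableSet S :=
    (hXU.mono hΦU).measurableSet_inter_fiber Φ.open_source y
  have hPm : Measurable P := P.continuous.measurable
  have hPL : LipschitzOnWith 1 P S := by
    refine LipschitzWith.lipschitzOnWith ?_
    refine LipschitzWith.of_dist_le_mul fun a b => ?_
    rw [dist_eq_norm, dist_eq_norm, ← map_sub, NNReal.coe_one, one_mul]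
    exact A.ker.norm_orthogonalProjectionOnto_apply_le _
  have hlow := hPL.euclideanHausdorffMeasure_restrict_image_le_map hPm m
  have hup := map_euclideanHausdorffMeasure_restrict_le (P := P) (s := S) (K := K)
    (fun a ha b hb => hbi a ha.1 b hb.1 (ha.2.trans hb.2.symm)) hPm m
  have hψm : Measurable fun v => ENNReal.ofReal (ψ (y, v)) :=
    ENNReal.measurable_ofReal.comp (hcy y).measurable
  have hmap : ∫⁻ x in {x | x ∈ U ∧ X x = y}, ENNReal.ofReal (φ x) ∂μHE[m] =
      ∫⁻ v, ENNReal.ofReal (ψ (y, v)) ∂(((μHE[m] : Measure E).restrict S).map P) := by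
    rw [lintegral_map hψm hPm]
    have h1 : (fun x => ENNReal.ofReal (φ x)) =
        Φ.source.indicator fun x => ENNReal.ofReal (φ x) := by
      refine (indicator_eq_self.2 fun x hx => hφN (subset_tsupport _ fun h => hx ?_)).symm
      simp [h]
    rw [h1, lintegral_indicator Φ.open_source.measurableSet,
      Measure.restrict_restrict Φ.open_source.measurableSet]
    have h2 : Φ.source ∩ {x | x ∈ U ∧ X x = y} = S := by
      ext x
      exact ⟨fun h => ⟨h.1, h.2.2⟩, fun h => ⟨h.1, hΦU h.1, h.2⟩⟩
    rw [h2]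
    refine setLIntegral_congr_fun hSm fun x hx => ?_
    rw [← hψφ x hx.1, hx.2]
  have himg : P '' S = {v | (y, v) ∈ Φ.target} := by
    ext v
    constructor
    · rintro ⟨x, hx, rfl⟩
      have := Φ.map_source hx.1
      rwa [hΦ, hx.2] at this
    · intro hv
      have h1 := Φ.right_inv hv
      rw [hΦ, Prod.mk.injEq] at h1
      exact ⟨Φ.symm (y, v), ⟨Φ.map_target hv, h1.1⟩, h1.2⟩
  have himgm : MeasurableSet (P '' S) := by
    rw [himg]
    exact (Φ.open_target.preimage (by fun_prop : Continuous fun v : A.ker => (y, v))).measurableSet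
  have hJ : ENNReal.ofReal (∫ v, ψ (y, v) ∂μHE[m]) =
      ∫⁻ v, ENNReal.ofReal (ψ (y, v)) ∂(μHE[m] : Measure A.ker) :=
    ofReal_integral_eq_lintegral_ofReal (hint y) (Filter.Eventually.of_forall fun v => hψ0 _)
  rw [hmap, hJ]
  constructor
  -- `hlow` only sees `P '' S`, but `ψ (y, ·)` vanishes off it.
  · have h1 : (fun v => ENNReal.ofReal (ψ (y, v))) =
        (P '' S).indicator fun v => ENNReal.ofReal (ψ (y, v)) := by
      refine (indicator_eq_self.2 fun v hv => ?_).symm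
      rw [himg]
      by_contra h
      refine hv ?_
      have h2 : ψ (y, v) = 0 := indicator_of_notMem (s := Φ.target) h _
      simp only [h2, ENNReal.ofReal_zero]
    rw [h1, lintegral_indicator himgm, ← h1]
    exact lintegral_mono' hlow le_rfl
  · calc _ ≤ ∫⁻ v, ENNReal.ofReal (ψ (y, v)) ∂((K : ℝ≥0∞) ^ m • (μHE[m] : Measure A.ker)) :=
        lintegral_mono' hup le_rfl
      _ = (K : ℝ≥0∞) ^ m * ∫⁻ v, ENNReal.ofReal (ψ (y, v)) ∂(μHE[m] : Measure A.ker) := by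
        rw [lintegral_smul_measure, smul_eq_mul]
      _ ≤ _ := by
        gcongr
        exact_mod_cast hKc

end Local

/-! ### Globalization by a partition of unity -/

section Global

variable {E F : Type*} [NormedAddCommGroup E] [InnerProductSpace ℝ E] [FiniteDimensional ℝ E]
    [NormedAddCommGroup F] [NormedSpace ℝ F] [FiniteDimensional ℝ F]
    [MeasurableSpace E] [BorelSpace E] {X : E → F} {U : Set E} {m : ℕ} {f : E → ℝ}

/-- The local neighborhoods do not depend on `φ`, so a partition of unity subordinate to finitely
many of them cuts `f` into admissible pieces; the bounds, all with the same `c`, add up. -/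
theorem exists_continuous_le_lintegral_fiber_le (hU : IsOpen U) (hXU : ContinuousOn X U)
    (hf : Continuous f) (hf0 : ∀ x, 0 ≤ f x) (hfs : HasCompactSupport f) (hfU : tsupport f ⊆ U)
    (hreg : ∀ p ∈ tsupport f, ∃ A : E →L[ℝ] F,
      HasStrictFDerivAt X A p ∧ Function.Surjective A ∧ finrank ℝ A.ker = m)
    {c : ℝ≥0} (hc : 1 < c) :
    ∃ J : F → ℝ, Continuous J ∧ (∀ y, 0 ≤ J y) ∧ ∀ y,
      ENNReal.ofReal (J y) ≤
        ∫⁻ x in {x | x ∈ U ∧ X x = y}, ENNReal.ofReal (f x) ∂μHE[m] ∧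
      ∫⁻ x in {x | x ∈ U ∧ X x = y}, ENNReal.ofReal (f x) ∂μHE[m] ≤
        c * ENNReal.ofReal (J y) := by
  have hloc : ∀ p : tsupport f, ∃ N : Set E, IsOpen N ∧ (p : E) ∈ N ∧ ∀ φ : E → ℝ,
      Continuous φ → (∀ x, 0 ≤ φ x) → HasCompactSupport φ → tsupport φ ⊆ N →
      ∃ J : F → ℝ, Continuous J ∧ (∀ y, 0 ≤ J y) ∧ ∀ y,
        ENNReal.ofReal (J y) ≤
          ∫⁻ x in {x | x ∈ U ∧ X x = y}, ENNReal.ofReal (φ x) ∂μHE[m] ∧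
        ∫⁻ x in {x | x ∈ U ∧ X x = y}, ENNReal.ofReal (φ x) ∂μHE[m] ≤
          c * ENNReal.ofReal (J y) := by
    rintro ⟨p, hp⟩
    obtain ⟨A, hA, hAs, rfl⟩ := hreg p hp
    exact hA.exists_continuous_le_lintegral_fiber_le hAs hU (hfU hp) hXU hc
  choose N hNo hpN hN using hloc
  obtain ⟨t, ht⟩ := hfs.elim_finite_subcover N hNo
    fun p hp => mem_iUnion.2 ⟨⟨p, hp⟩, hpN _⟩
  obtain ⟨ρ, hρN, hρ1, hρI, -⟩ := exists_continuous_sum_one_of_isOpen_isCompact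
    (s := fun i => N (t.equivFin.symm i)) (fun i => hNo _) hfs (ht.trans fun x hx => by
      simp only [mem_iUnion] at hx ⊢
      obtain ⟨p, hp, hx⟩ := hx
      exact ⟨t.equivFin ⟨p, hp⟩, by simpa using hx⟩)
  have hsum : ∀ x, f x = ∑ i, ρ i x * f x := fun x => by
    rw [← Finset.sum_mul]
    by_cases hx : x ∈ tsupport f
    · have := hρ1 hx
      rw [Finset.sum_apply, Pi.one_apply] at this
      rw [this, one_mul]
    · rw [image_eq_zero_of_notMem_tsupport hx, mul_zero]
  have hterm0 : ∀ i x, 0 ≤ ρ i x * f x := fun i x => mul_nonneg (hρI i x).1 (hf0 x)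
  have hpiece := fun i => hN (t.equivFin.symm i) (fun x => ρ i x * f x)
    ((ρ i).continuous.mul hf) (hterm0 i) hfs.mul_left
    ((closure_mono (Function.support_mul_subset_left _ _)).trans (hρN i))
  choose J hJc hJ0 hJ using hpiece
  have hlin : ∀ y, ∫⁻ x in {x | x ∈ U ∧ X x = y}, ENNReal.ofReal (f x) ∂μHE[m] =
      ∑ i, ∫⁻ x in {x | x ∈ U ∧ X x = y}, ENNReal.ofReal (ρ i x * f x) ∂μHE[m] := fun y => by
    have hmeas : ∀ i, Measurable fun x => ENNReal.ofReal (ρ i x * f x) := fun i =>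
      (ENNReal.continuous_ofReal.comp ((ρ i).continuous.mul hf)).measurable
    rw [← lintegral_finsetSum _ fun i _ => hmeas i]
    refine lintegral_congr fun x => ?_
    rw [← ENNReal.ofReal_sum_of_nonneg fun i _ => hterm0 i x, ← hsum]
  refine ⟨fun y => ∑ i, J i y, continuous_finsetSum _ fun i _ => hJc i,
    fun y => Finset.sum_nonneg fun i _ => hJ0 i y, fun y => ?_⟩
  rw [hlin, ENNReal.ofReal_sum_of_nonneg fun i _ => hJ0 i y, Finset.mul_sum]
  exact ⟨Finset.sum_le_sum fun i _ => (hJ i y).1, Finset.sum_le_sum fun i _ => (hJ i y).2⟩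

theorem integrableOn_fiber_and_continuous_integral_of_nonneg
    (hU : IsOpen U) (hXU : ContinuousOn X U)
    (hf : Continuous f) (hf0 : ∀ x, 0 ≤ f x) (hfs : HasCompactSupport f) (hfU : tsupport f ⊆ U)
    (hreg : ∀ p ∈ tsupport f, ∃ A : E →L[ℝ] F,
      HasStrictFDerivAt X A p ∧ Function.Surjective A ∧ finrank ℝ A.ker = m) :
    (∀ y, IntegrableOn f {x | x ∈ U ∧ X x = y} μHE[m]) ∧
      Continuous fun y => ∫ x in {x | x ∈ U ∧ X x = y}, f x ∂μHE[m] := by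
  have key := fun c => exists_continuous_le_lintegral_fiber_le hU hXU hf hf0 hfs hfU hreg (c := c)
  have hfin : ∀ y, ∫⁻ x in {x | x ∈ U ∧ X x = y}, ENNReal.ofReal (f x) ∂μHE[m] < ∞ := fun y => by
    obtain ⟨J, -, -, hJ⟩ := key 2 one_lt_two
    exact (hJ y).2.trans_lt (ENNReal.mul_lt_top ENNReal.coe_lt_top ENNReal.ofReal_lt_top)
  refine ⟨fun y => ⟨hf.aestronglyMeasurable, ?_⟩, ?_⟩
  · rw [hasFiniteIntegral_iff_ofReal (Filter.Eventually.of_forall hf0)]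
    exact hfin y
  · refine continuous_of_forall_exists_le_mul fun c hc => ?_
    obtain ⟨J, hJc, hJ0, hJ⟩ := key c.toNNReal (by simpa using hc)
    refine ⟨J, hJc, fun y => ?_⟩
    rw [integral_eq_lintegral_of_nonneg_ae (Filter.Eventually.of_forall hf0)
      hf.aestronglyMeasurable]
    constructor
    · exact (ENNReal.ofReal_le_iff_le_toReal (hfin y).ne).1 (hJ y).1
    · refine ENNReal.toReal_le_of_le_ofReal (mul_nonneg (by linarith) (hJ0 y)) ?_
      rw [ENNReal.ofReal_mul (by linarith)]
      exact (hJ y).2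

/-- The integral of a compactly supported function, whose support consists of regular points of
`X`, over the fibers of `X` is finite and depends continuously on the fiber. -/
theorem integrableOn_fiber_and_continuous_integral
    (hU : IsOpen U) (hXU : ContinuousOn X U)
    (hf : Continuous f) (hfs : HasCompactSupport f) (hfU : tsupport f ⊆ U)
    (hreg : ∀ p ∈ tsupport f, ∃ A : E →L[ℝ] F,
      HasStrictFDerivAt X A p ∧ Function.Surjective A ∧ finrank ℝ A.ker = m) :
    (∀ y, IntegrableOn f {x | x ∈ U ∧ X x = y} μHE[m]) ∧
      Continuous fun y => ∫ x in {x | x ∈ U ∧ X x = y}, f x ∂μHE[m] := by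
  -- Applied to positive and negative parts; `g 0 = 0` keeps the support inside `tsupport f`.
  have aux : ∀ g : ℝ → ℝ, Continuous g → g 0 = 0 → (∀ r, 0 ≤ g r) →
      (∀ y, IntegrableOn (fun x => g (f x)) {x | x ∈ U ∧ X x = y} μHE[m]) ∧
        Continuous fun y => ∫ x in {x | x ∈ U ∧ X x = y}, g (f x) ∂μHE[m] := by
    intro g hg hg0 hgn
    have hsub : tsupport (fun x => g (f x)) ⊆ tsupport f :=
      closure_mono (Function.support_comp_subset hg0 f)
    exact integrableOn_fiber_and_continuous_integral_of_nonneg hU hXU (hg.comp hf)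
      (fun x => hgn _) (hfs.comp_left hg0) (hsub.trans hfU) fun p hp => hreg p (hsub hp)
  obtain ⟨hi₁, hc₁⟩ := aux (fun r => max r 0) (by fun_prop) (by simp) fun r => le_max_right _ _
  obtain ⟨hi₂, hc₂⟩ := aux (fun r => max (-r) 0) (by fun_prop) (by simp) fun r => le_max_right _ _
  have hdec : f = fun x => max (f x) 0 - max (-f x) 0 := by
    ext x
    rw [max_zero_sub_max_neg_zero_eq_self]
  constructor
  · intro y
    rw [hdec]
    exact (hi₁ y).sub (hi₂ y)
  · refine (hc₁.sub hc₂).congr fun y => ?_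
    rw [Pi.sub_apply, ← integral_sub (hi₁ y) (hi₂ y)]
    simp only [max_zero_sub_max_neg_zero_eq_self]

end Global

/-! ### The main theorem -/

theorem mainTheorem5 (d j : ℕ) (hj : 0 < j) (hjd : j ≤ d)
    (D : Set (EuclideanSpace ℝ (Fin d))) (hDo : IsOpen D) (hDc : Convex ℝ D)
    (X : EuclideanSpace ℝ (Fin d) → EuclideanSpace ℝ (Fin j))
    (hX : ContDiffOn ℝ 1 X D)
    (hLip : ∃ L : NNReal, LipschitzOnWith L (fderiv ℝ X) D)
    (D₁ : Set (EuclideanSpace ℝ (Fin d))) (hD₁o : IsOpen D₁)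
    (hD₁b : Bornology.IsBounded D₁) (hD₁D : D₁ ⊆ D)
    (Y : EuclideanSpace ℝ (Fin d) → ℝ) (hY : ContinuousOn Y D₁)
    (hsupp : supportOn D₁ Y ⊆ regularSet D₁ X) :
    (∀ y : EuclideanSpace ℝ (Fin j),
      IntegrableOn Y (regularLevelSet D D₁ X y) μHE[d - j]) ∧
    Continuous fun y : EuclideanSpace ℝ (Fin j) =>
      ∫ x in regularLevelSet D D₁ X y, Y x ∂μHE[d - j] := by
  set S := supportOn D₁ Y with hS
  have hSD : S ⊆ D₁ := fun x hx => (hsupp hx).1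
  have hScomp : IsCompact S :=
    Metric.isCompact_of_isClosed_isBounded isClosed_closure (hD₁b.subset hSD)
  set f : EuclideanSpace ℝ (Fin d) → ℝ := D₁.indicator Y with hf
  have hfsub : tsupport f ⊆ S := closure_mono fun x hx => by
    have hx1 : x ∈ D₁ := by
      by_contra h
      exact hx (indicator_of_notMem h _)
    refine ⟨hx1, ?_⟩
    rwa [Function.mem_support, hf, indicator_of_mem hx1] at hx
  have hfs : HasCompactSupport f := hScomp.of_isClosed_subset isClosed_closure hfsub
  have hfc : Continuous f := by
    refine continuous_of_tsupport fun x hx => ?_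
    have hx1 := hD₁o.mem_nhds (hSD (hfsub hx))
    refine (hY.continuousAt hx1).congr ?_
    filter_upwards [hx1] with z hz
    rw [hf, indicator_of_mem hz]
  have hreg : ∀ p ∈ tsupport f, ∃ A : EuclideanSpace ℝ (Fin d) →L[ℝ] EuclideanSpace ℝ (Fin j),
      HasStrictFDerivAt X A p ∧ Function.Surjective A ∧ finrank ℝ A.ker = d - j := by
    intro p hp
    obtain ⟨hp1, hp2⟩ := hsupp (hfsub hp)
    refine ⟨fderiv ℝ X p,
      (hX.contDiffAt (hDo.mem_nhds (hD₁D hp1))).hasStrictFDerivAt one_ne_zero, ?_, ?_⟩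
    · refine LinearMap.range_eq_top.1 (Submodule.eq_top_of_finrank_eq ?_)
      rw [finrank_euclideanSpace_fin]
      exact hp2
    · have h := LinearMap.finrank_range_add_finrank_ker (fderiv ℝ X p).toLinearMap
      rw [hp2, finrank_euclideanSpace_fin] at h
      omega
  have hXD₁ : ContinuousOn X D₁ := hX.continuousOn.mono hD₁D
  obtain ⟨hint, hcont⟩ := integrableOn_fiber_and_continuous_integral hD₁o hXD₁ hfc hfs
    (hfsub.trans hSD) hreg
  have hsub : ∀ y, regularLevelSet D D₁ X y ⊆ {x | x ∈ D₁ ∧ X x = y} :=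
    fun y x hx => ⟨hx.1.2, hx.1.1.2⟩
  have hmeas := fun y => hXD₁.measurableSet_inter_fiber hD₁o y
  have hfY : ∀ y, EqOn f Y {x | x ∈ D₁ ∧ X x = y} := fun y x hx => indicator_of_mem hx.1 _
  constructor
  · intro y
    exact ((integrableOn_congr_fun (hfY y) (hmeas y)).1 (hint y)).mono_set (hsub y)
  · refine hcont.congr fun y => ?_
    rw [setIntegral_congr_fun (hmeas y) (hfY y)]
    -- The full fiber in `D₁` exceeds its regular part only at points where `Y` vanishes, by
    -- `hsupp`.
    refine setIntegral_eq_of_subset_of_forall_sdiff_eq_zero (hmeas y) (hsub y) fun x hx => ?_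
    by_contra h
    have hxr := hsupp (subset_closure ⟨hx.1.1, h⟩)
    exact hx.2 ⟨⟨⟨hD₁D hx.1.1, hx.1.2⟩, hx.1.1⟩, hD₁D hx.1.1, hxr.2⟩
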